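/- For integers $m,n\ge 1$ and a positive semidefinite $m\times m$ matrix $S$, let $W_m(n,S)$ be the law of $\sum_{i=1}^{n} z_iz_i^T$ with $z_1,\dots,z_n$ independent $N_m(0,S)$ vectors; let $\chi^2_k$ be the law of the sum of squares of $k$ independent standard normal variables ($\chi^2_0$ is the point mass at $0$); let $\ell_1(H)$ be the largest eigenvalue of $H$. Fix integers $m,n_H\ge 1$. (a) Fix $\lambda_H>0$. For every $\sigma>0$ let $v$ be a unit vector of $\mathbb{R}^m$ (which may depend on $\sigma$) and let $H=H_\sigma\sim W_m(n_H,\sigma^2 I+\lambda_H vv^T)$, all defined on one probability space. Then, on a suitable extension of this probability space (which may be the space itself), there are for every $\sigma>0$ three independent variates $\chi^2_{n_H}$, $\chi^2_{m-1}$, $\chi^2_{n_H-1}$ with the chi-square laws of the indicated degrees of freedom, such that, as $\sigma\to 0$ with $(m,n_H,\lambda_H)$ fixed, $$\ell_1(H)=(\lambda_H+\sigma^2)\,\chi^2_{n_H}+\chi^2_{m-1}\,\sigma^2+\frac{\chi^2_{m-1}\,\chi^2_{n_H-1}}{(\lambda_H+\sigma^2)\,\chi^2_{n_H}}\,\sigma^4+o_p(\sigma^4),$$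 where $R=o_p(r)$ means that $R/r\to 0$ in probability. (b) Fix $\sigma>0$ instead. For every $\lambda_H>0$ let $v$ be a unit vector (which may depend on $\lambda_H$) and let $H=H_{\lambda_H}\sim W_m(n_H,\sigma^2 I+\lambda_H vv^T)$, all on one probability space. Then, on a suitable extension of it, there are for every $\lambda_H>0$ three independent variates with the same chi-square laws such that, as $\lambda_H\to\infty$ with $(m,n_H,\sigma)$ fixed, the same expansion holds with error term $o_p(1/\lambda_H)$ in place of $o_p(\sigma^4)$. -/

import Mathlib

open MeasureTheory ProbabilityTheory Filter Topology

universe u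

/-- Matrices carry the product σ-algebra of their entries. -/
instance Matrix.instMeasurableSpaceReal {m n : ℕ} :
    MeasurableSpace (Matrix (Fin m) (Fin n) ℝ) :=
  inferInstanceAs (MeasurableSpace (Fin m → Fin n → ℝ))

/-- The central Wishart law `W_m(n, S)`: the law of the matrix `∑ i, z_i z_iᵀ`, where
`z_1, …, z_n` are independent Gaussian vectors of `ℝ^m` with mean `0` and covariance `S`. -/
noncomputable def wishart (m n : ℕ) (S : Matrix (Fin m) (Fin m) ℝ) :
    Measure (Matrix (Fin m) (Fin m) ℝ) :=
  (Measure.pi fun _ : Fin n => multivariateGaussian (0 : EuclideanSpace ℝ (Fin m)) S).map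
    fun z => ∑ i, Matrix.vecMulVec (z i) (z i)

/-- The chi-square law with `k` degrees of freedom: the law of the sum of the squares of `k`
independent standard normal variables (the point mass at `0` if `k = 0`). -/
noncomputable def chiSquare (k : ℕ) : Measure ℝ :=
  (Measure.pi fun _ : Fin k => gaussianReal 0 1).map fun z => ∑ i, z i ^ 2

/-- The largest (real) eigenvalue of a real square matrix. -/
noncomputable def largestEigenvalue {m : ℕ} (A : Matrix (Fin m) (Fin m) ℝ) : ℝ :=
  sSup (spectrum ℝ A)

/-- The spiked covariance matrix `σ² I + lam v vᵀ`. -/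
noncomputable def spikedCov {m : ℕ} (σ lam : ℝ) (v : EuclideanSpace ℝ (Fin m)) :
    Matrix (Fin m) (Fin m) ℝ :=
  σ ^ 2 • (1 : Matrix (Fin m) (Fin m) ℝ) + lam • Matrix.vecMulVec v v

/-- `X, Y, Z` are independent chi-square variates with `n`, `m - 1` and `n - 1` degrees of
freedom (used for `1 ≤ m` and `1 ≤ n`). -/
structure IsChiSquareTriple {Ω : Type*} [MeasurableSpace Ω] (P : Measure Ω) (m n : ℕ)
    (X Y Z : Ω → ℝ) : Prop where
  law_X : HasLaw X (chiSquare n) P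
  law_Y : HasLaw Y (chiSquare (m - 1)) P
  law_Z : HasLaw Z (chiSquare (n - 1)) P
  indep : iIndepFun ![X, Y, Z] P

/-- The expansion `(lam + σ²) x + y σ² + y z / ((lam + σ²) x) σ⁴` of the largest eigenvalue. -/
noncomputable def rootExpansion (σ lam x y z : ℝ) : ℝ :=
  (lam + σ ^ 2) * x + y * σ ^ 2 + y * z / ((lam + σ ^ 2) * x) * σ ^ 4

/-- `R t = o_p(r t)` along the filter `l`: the quotients `R t / r t` tend to `0` in probability
(used with `r t ≠ 0`). -/
def IsLittleOInProbability {ι Ω : Type*} [MeasurableSpace Ω] (P : Measure Ω) (l : Filter ι)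
    (R : ι → Ω → ℝ) (r : ι → ℝ) : Prop :=
  TendstoInMeasure P (fun t ω => R t ω / r t) l (fun _ => 0)

/-! ### Rayleigh bounds for the largest eigenvalue. -/

namespace Matrix.IsHermitian

variable {m : ℕ} {A : Matrix (Fin m) (Fin m) ℝ}

/-! Write `H = M Mᵀ`, and use an orthonormal basis of `ℝ^m` starting with `v`. The rows of `M` are
then `s ξ`, with `s² = lam + σ²`, and `m - 1` rows `σ r_j`, all of `ξ, r_j` being independent
standard Gaussian vectors of `ℝ^n`. An orthogonal map depending on `ξ` alone turns `ξ` into `‖ξ‖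
e₀`, and leaves the other rows Gaussian and independent of `ξ`. Let `w` collect the first
coordinates of the rotated `r_j`, let `B` be the map formed by the remaining ones, and put `a =
s‖ξ‖`. The quadratic form of `H` becomes `(α a + σ⟪β, w⟫)² + σ²‖B β‖²`: a rank-one form with top
vector `(a, σ w)`, plus a small perturbation. Its Rayleigh quotients give the top eigenvalue as `a²
+ σ²‖w‖² + σ⁴‖B w‖² / a²` up to order `σ⁶ / a⁴` (`abs_largestEigenvalue_sub_le`).

Here `‖ξ‖²` and `‖w‖²` are the first two chi-squares. Given `w ≠ 0`, `B w / ‖w‖` is standard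
Gaussian in `ℝ^(n-1)` whatever `w` is, so `‖B w‖² = ‖w‖² Z` with `Z` the third chi-square,
independent of the others (`measurePreserving_sourceXYZ`).

A prescribed `H` is coupled to such Gaussian data by one auxiliary uniform variable
(`exists_hasLaw_comp_eq_fst`). Almost surely, where the perturbation is small enough, the error is
at most `σ⁶ / lam²` times a variable of fixed law; both limits are the regime `σ² / lam → 0`. -/

lemma dotProduct_mulVec_le_largestEigenvalue (hA : A.IsHermitian) (x : Fin m → ℝ) :
    x ⬝ᵥ A *ᵥ x ≤ largestEigenvalue A * (x ⬝ᵥ x) := by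
  have hbdd : BddAbove (spectrum ℝ A) := by
    rw [hA.spectrum_real_eq_range_eigenvalues]
    exact (Set.finite_range _).bddAbove
  have hB : (algebraMap ℝ (Matrix (Fin m) (Fin m) ℝ) (largestEigenvalue A) - A).IsHermitian := by
    refine IsHermitian.sub ?_ hA
    rw [Algebra.algebraMap_eq_smul_one]
    simp [IsHermitian]
  have hpos : (algebraMap ℝ (Matrix (Fin m) (Fin m) ℝ) (largestEigenvalue A) - A).PosSemidef := by
    rw [hB.posSemidef_iff_eigenvalues_nonneg]
    intro i
    have hi := hB.eigenvalues_mem_spectrum_real i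
    rw [← spectrum.singleton_sub_eq] at hi
    obtain ⟨_, rfl, y, hy, hxy⟩ := hi
    have := le_csSup hbdd hy
    simp only [Pi.zero_apply, ← hxy]
    exact sub_nonneg.2 this
  have h := hpos.dotProduct_mulVec_nonneg x
  rw [Algebra.algebraMap_eq_smul_one, Matrix.sub_mulVec, Matrix.smul_mulVec, Matrix.one_mulVec,
    dotProduct_sub, dotProduct_smul] at h
  simp only [star_trivial, smul_eq_mul] at h
  linarith

/-- Test on eigenvectors. For `m = 0` the supremum of the empty spectrum is `0`, which a negative
`T` would not bound. -/
lemma largestEigenvalue_le [NeZero m] (hA : A.IsHermitian) {T : ℝ}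
    (h : ∀ x : Fin m → ℝ, x ⬝ᵥ A *ᵥ x ≤ T * (x ⬝ᵥ x)) : largestEigenvalue A ≤ T := by
  unfold largestEigenvalue
  rw [hA.spectrum_real_eq_range_eigenvalues]
  refine csSup_le (Set.range_nonempty _) ?_
  rintro _ ⟨i, rfl⟩
  have h1 := h (hA.eigenvectorBasis i)
  have h2 := hA.mulVec_eigenvectorBasis i
  have h3 : (hA.eigenvectorBasis i : Fin m → ℝ) ⬝ᵥ (hA.eigenvectorBasis i : Fin m → ℝ) = 1 := by
    have := EuclideanSpace.real_norm_sq_eq (hA.eigenvectorBasis i)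
    rw [hA.eigenvectorBasis.orthonormal.1 i, one_pow] at this
    simpa [dotProduct, pow_two] using this.symm
  rw [h2, dotProduct_smul, h3] at h1
  simpa using h1

end Matrix.IsHermitian

/-! ### Rayleigh quotients of a rank-one form with a small perturbation. -/

section Rayleigh

variable {V U : Type*} [NormedAddCommGroup V] [InnerProductSpace ℝ V]
  [NormedAddCommGroup U] [InnerProductSpace ℝ U]

open scoped RealInnerProductSpace

/-- Split `(α, β)` into a multiple `t` of the top vector `(a, σ w)` of the rank-one part and an
orthogonal rest `(α', β')`, on which that part vanishes. The rest leaves a spectral gap of at least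
`a²`: one half of `a²‖β'‖²` absorbs the cross term, the other half absorbs `σ²‖B β'‖²`, by the
smallness hypothesis. -/
lemma bordered_rayleigh_le (B : V →ₗ[ℝ] U) (w β : V) {a F : ℝ} (α σ : ℝ) (ha : 0 < a)
    (hB : ∀ x, ‖B x‖ ^ 2 ≤ F * ‖x‖ ^ 2) (hF : 0 ≤ F) (h : 2 * σ ^ 2 * F ≤ a ^ 2) :
    (α * a + σ * ⟪β, w⟫) ^ 2 + σ ^ 2 * ‖B β‖ ^ 2 ≤
      (a ^ 2 + σ ^ 2 * ‖w‖ ^ 2 + σ ^ 4 * ‖B w‖ ^ 2 / a ^ 2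
        + 2 * σ ^ 6 * ‖B w‖ ^ 2 * F / a ^ 4) * (α ^ 2 + ‖β‖ ^ 2) := by
  set A := a ^ 2 + σ ^ 2 * ‖w‖ ^ 2 with hAdef
  have ha2 : 0 < a ^ 2 := by positivity
  have hA : a ^ 2 ≤ A := le_add_of_nonneg_right (by positivity)
  have hA0 : 0 < A := by linarith
  set t := (α * a + σ * ⟪β, w⟫) / A with ht
  set α' := α - t * a
  set β' := β - (t * σ) • w
  have hα : α = t * a + α' := by simp [α']
  have hβ : β = (t * σ) • w + β' := by simp [β']
  have htA : α * a + σ * ⟪β, w⟫ = t * A := by rw [ht]; field_simp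
  have horth : α' * a + σ * ⟪β', w⟫ = 0 := by
    have : α' * a + σ * ⟪β', w⟫ = α * a + σ * ⟪β, w⟫ - t * A := by
      simp only [α', β', inner_sub_left, real_inner_smul_left, real_inner_self_eq_norm_sq, hAdef]
      ring
    rw [this, htA, sub_self]
  have hnorm : α ^ 2 + ‖β‖ ^ 2 = t ^ 2 * A + α' ^ 2 + ‖β'‖ ^ 2 := by
    have h1 : ‖β‖ ^ 2 = (t * σ) ^ 2 * ‖w‖ ^ 2 + 2 * (t * σ) * ⟪β', w⟫ + ‖β'‖ ^ 2 := by
      rw [hβ, norm_add_sq_real, norm_smul, real_inner_smul_left, mul_pow, real_inner_comm,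
        Real.norm_eq_abs, sq_abs]
      ring
    rw [h1, hα, hAdef]
    linear_combination 2 * t * horth
  have hBβ : ‖B β‖ ^ 2 = (t * σ) ^ 2 * ‖B w‖ ^ 2 + 2 * (t * σ) * ⟪B w, B β'⟫ + ‖B β'‖ ^ 2 := by
    rw [hβ, map_add, map_smul, norm_add_sq_real, norm_smul, real_inner_smul_left, mul_pow,
      Real.norm_eq_abs, sq_abs]
    ring
  have hcs : ⟪B w, B β'⟫ ^ 2 ≤ ‖B w‖ ^ 2 * (F * ‖β'‖ ^ 2) := by
    calc ⟪B w, B β'⟫ ^ 2 ≤ (‖B w‖ * ‖B β'‖) ^ 2 :=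
          sq_le_sq' (neg_le_of_abs_le (abs_real_inner_le_norm _ _)) (real_inner_le_norm _ _)
      _ = ‖B w‖ ^ 2 * ‖B β'‖ ^ 2 := by ring
      _ ≤ _ := by gcongr; exact hB β'
  set q := ⟪B w, B β'⟫
  -- Weighted AM-GM after Cauchy–Schwarz, with the weight chosen to spend exactly half of the gap.
  have hcross : 2 * t * σ ^ 3 * q ≤ a ^ 2 / 2 * ‖β'‖ ^ 2 +
      2 * t ^ 2 * σ ^ 6 * ‖B w‖ ^ 2 * F / a ^ 2 := by
    have hnn : 0 ≤ a ^ 2 / 2 * ‖β'‖ ^ 2 + 2 * t ^ 2 * σ ^ 6 * ‖B w‖ ^ 2 * F / a ^ 2 := by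
      positivity
    refine le_of_sq_le_sq ?_ hnn
    have h1 : (a ^ 2 / 2 * ‖β'‖ ^ 2 + 2 * t ^ 2 * σ ^ 6 * ‖B w‖ ^ 2 * F / a ^ 2) ^ 2 =
        (a ^ 2 / 2 * ‖β'‖ ^ 2 - 2 * t ^ 2 * σ ^ 6 * ‖B w‖ ^ 2 * F / a ^ 2) ^ 2 +
        4 * t ^ 2 * σ ^ 6 * (‖B w‖ ^ 2 * (F * ‖β'‖ ^ 2)) := by
      field_simp
      ring
    rw [h1]
    have h2 : 4 * t ^ 2 * σ ^ 6 * q ^ 2 ≤ 4 * t ^ 2 * σ ^ 6 * (‖B w‖ ^ 2 * (F * ‖β'‖ ^ 2)) := by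
      gcongr
    nlinarith [sq_nonneg (a ^ 2 / 2 * ‖β'‖ ^ 2 - 2 * t ^ 2 * σ ^ 6 * ‖B w‖ ^ 2 * F / a ^ 2)]
  set D := σ ^ 4 * ‖B w‖ ^ 2 / a ^ 2 + 2 * σ ^ 6 * ‖B w‖ ^ 2 * F / a ^ 4 with hD
  have hD0 : 0 ≤ D := by positivity
  have hDA : σ ^ 4 * ‖B w‖ ^ 2 + 2 * σ ^ 6 * ‖B w‖ ^ 2 * F / a ^ 2 ≤ D * A := by
    calc _ = D * a ^ 2 := by rw [hD]; field_simp
      _ ≤ _ := by gcongr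
  have hβ'2 : σ ^ 2 * ‖B β'‖ ^ 2 ≤ a ^ 2 / 2 * ‖β'‖ ^ 2 := by
    calc σ ^ 2 * ‖B β'‖ ^ 2 ≤ σ ^ 2 * (F * ‖β'‖ ^ 2) := by gcongr; exact hB β'
      _ = (σ ^ 2 * F) * ‖β'‖ ^ 2 := by ring
      _ ≤ _ := by gcongr; linarith
  rw [htA, hnorm, hBβ, add_assoc A, ← hD]
  have e1 : (a ^ 2) * ‖β'‖ ^ 2 ≤ (A + D) * ‖β'‖ ^ 2 := by gcongr; linarith
  have e2 : 0 ≤ (A + D) * α' ^ 2 := by positivity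
  have e3 := mul_le_mul_of_nonneg_left hDA (sq_nonneg t)
  have e4 : t ^ 2 * (σ ^ 4 * ‖B w‖ ^ 2 + 2 * σ ^ 6 * ‖B w‖ ^ 2 * F / a ^ 2) =
    t ^ 2 * σ ^ 4 * ‖B w‖ ^ 2 + 2 * t ^ 2 * σ ^ 6 * ‖B w‖ ^ 2 * F / a ^ 2 := by ring
  rw [e4] at e3
  linarith

end Rayleigh

/-- The hypothesis is the Rayleigh bound at the trial vector `(a, σ w)`; the conclusion follows from
`1 / (1 + u) ≥ 1 - u` with `u = σ² y / a²`. -/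
lemma rayleigh_lower_bound {a y θ L : ℝ} (σ : ℝ) (ha : 0 < a) (hy : 0 ≤ y) (hθ : 0 ≤ θ)
    (h : (a ^ 2 + σ ^ 2 * y) ^ 2 + σ ^ 4 * θ ≤ L * (a ^ 2 + σ ^ 2 * y)) :
    a ^ 2 + σ ^ 2 * y + σ ^ 4 * θ / a ^ 2 - σ ^ 6 * θ * y / a ^ 4 ≤ L := by
  have hA : 0 < a ^ 2 + σ ^ 2 * y := by positivity
  have h1 : a ^ 2 + σ ^ 2 * y + σ ^ 4 * θ / (a ^ 2 + σ ^ 2 * y) ≤ L := by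
    rw [← mul_le_mul_iff_left₀ hA]
    refine le_of_eq_of_le ?_ h
    field_simp
  refine le_trans ?_ h1
  have h2 : σ ^ 4 * θ / (a ^ 2 + σ ^ 2 * y) - (σ ^ 4 * θ / a ^ 2 - σ ^ 6 * θ * y / a ^ 4) =
      σ ^ 8 * θ * y ^ 2 / (a ^ 4 * (a ^ 2 + σ ^ 2 * y)) := by
    field_simp
    ring
  have h3 : 0 ≤ σ ^ 8 * θ * y ^ 2 / (a ^ 4 * (a ^ 2 + σ ^ 2 * y)) := by positivity
  linarith

/-! ### The spiked Gram matrix in rotated coordinates. -/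

open scoped Matrix RealInnerProductSpace in
lemma dotProduct_sum_vecMulVec_mulVec {m n : ℕ} (z : Fin n → EuclideanSpace ℝ (Fin m))
    (x : Fin m → ℝ) :
    x ⬝ᵥ (∑ i, Matrix.vecMulVec (z i) (z i)) *ᵥ x = ∑ i, ⟪z i, WithLp.toLp 2 x⟫ ^ 2 := by
  rw [Matrix.sum_mulVec, dotProduct_sum]
  refine Finset.sum_congr rfl fun i _ => ?_
  rw [Matrix.vecMulVec_mulVec, dotProduct_smul]
  simp only [MulOpposite.smul_eq_mul_unop, MulOpposite.unop_op,
    EuclideanSpace.inner_eq_star_dotProduct, star_trivial]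
  rw [dotProduct_comm (z i).ofLp x]
  ring

lemma isHermitian_sum_vecMulVec {m n : ℕ} (z : Fin n → EuclideanSpace ℝ (Fin m)) :
    (∑ i, Matrix.vecMulVec (z i) (z i)).IsHermitian := by
  rw [Matrix.IsHermitian, Matrix.conjTranspose_sum]
  refine Finset.sum_congr rfl fun i _ => ?_
  ext a b
  simp [Matrix.vecMulVec_apply, mul_comm]

/-- The reflection of `ℝ^(n+1)` that maps `x` to `‖x‖ e₀`, applied to `y`. -/
noncomputable def headReflection {n : ℕ} (x y : Fin (n + 1) → ℝ) : Fin (n + 1) → ℝ :=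
  ((ℝ ∙ (WithLp.toLp 2 x - EuclideanSpace.single 0 ‖WithLp.toLp 2 x‖))ᗮ.reflection
    (WithLp.toLp 2 y)).ofLp

/-- The columns of the matrix with rows `s ξ` and `σ Q r₀, σ Q r₁, …` in the basis `b`, where `Q`
is the reflection interchanging the directions of `ξ` and of the first basis vector. -/
noncomputable def spikedColumns {k n : ℕ}
    (b : OrthonormalBasis (Fin (k + 1)) ℝ (EuclideanSpace ℝ (Fin (k + 1)))) (s σ : ℝ)
    (ξ : Fin (n + 1) → ℝ) (r : Fin k → Fin (n + 1) → ℝ) (i : Fin (n + 1)) :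
    EuclideanSpace ℝ (Fin (k + 1)) :=
  (s * ξ i) • b 0 + ∑ j : Fin k, (σ * headReflection ξ (r j) i) • b j.succ

section Rayleigh

open scoped RealInnerProductSpace

variable {k n : ℕ} (b : OrthonormalBasis (Fin (k + 1)) ℝ (EuclideanSpace ℝ (Fin (k + 1))))
  (s σ : ℝ) (ξ : Fin (n + 1) → ℝ) (r : Fin k → Fin (n + 1) → ℝ)

/-- The inner products with `x` are the coordinates of `Q p`, where `p` is the combination of the
unrotated rows. Since `Q` is an isometry, their squares sum to `‖p‖²`, and `p` sees `ξ` only through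
its norm, in coordinate `0`. -/
lemma sum_inner_spikedColumns_sq (x : EuclideanSpace ℝ (Fin (k + 1))) :
    ∑ i, ⟪spikedColumns b s σ ξ r i, x⟫ ^ 2 =
      (⟪b 0, x⟫ * (s * ‖WithLp.toLp 2 ξ‖) + σ * ∑ j, ⟪b j.succ, x⟫ * r j 0) ^ 2 +
        σ ^ 2 * ∑ l : Fin n, (∑ j, ⟪b j.succ, x⟫ * r j l.succ) ^ 2 := by
  set Q := (ℝ ∙ (WithLp.toLp 2 ξ - EuclideanSpace.single 0 ‖WithLp.toLp 2 ξ‖))ᗮ.reflection with hQ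
  have hQξ : Q (EuclideanSpace.single 0 ‖WithLp.toLp 2 ξ‖) = WithLp.toLp 2 ξ := by
    have h : Q (WithLp.toLp 2 ξ) = EuclideanSpace.single 0 ‖WithLp.toLp 2 ξ‖ :=
      Submodule.reflection_sub (by simp)
    calc _ = Q (Q (WithLp.toLp 2 ξ)) := congrArg Q h.symm
      _ = _ := Submodule.reflection_reflection _ _
  set p : EuclideanSpace ℝ (Fin (n + 1)) :=
    (s * ⟪b 0, x⟫) • EuclideanSpace.single 0 ‖WithLp.toLp 2 ξ‖ +
      ∑ j, (σ * ⟪b j.succ, x⟫) • WithLp.toLp 2 (r j) with hp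
  have h1 : ∀ i, ⟪spikedColumns b s σ ξ r i, x⟫ = Q p i := by
    intro i
    rw [hp, map_add, map_smul, hQξ, map_sum]
    simp only [spikedColumns, headReflection, inner_add_left, real_inner_smul_left, sum_inner,
      map_smul, PiLp.add_apply, PiLp.smul_apply, smul_eq_mul, WithLp.ofLp_sum, Finset.sum_apply, ← hQ]
    congr 1
    · ring
    · refine Finset.sum_congr rfl fun j _ => ?_
      ring
  simp_rw [h1]
  rw [← EuclideanSpace.real_norm_sq_eq, LinearIsometryEquiv.norm_map,
    EuclideanSpace.real_norm_sq_eq, Fin.sum_univ_succ, hp]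
  congr 1
  · simp [Finset.mul_sum, mul_assoc]
    ring_nf
  · rw [Finset.mul_sum]
    refine Finset.sum_congr rfl fun l _ => ?_
    simp only [PiLp.add_apply, PiLp.smul_apply, smul_eq_mul, WithLp.ofLp_sum, Finset.sum_apply]
    rw [← mul_pow, Finset.mul_sum]
    simp [mul_assoc]

end Rayleigh

/-- The vector `∑ βⱼ rⱼ` without its first coordinate, as a linear map of `β`. -/
noncomputable def tailCombination {k n : ℕ} (r : Fin k → Fin (n + 1) → ℝ) :
    EuclideanSpace ℝ (Fin k) →ₗ[ℝ] EuclideanSpace ℝ (Fin n) where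
  toFun β := WithLp.toLp 2 fun l => ∑ j, β j * r j l.succ
  map_add' x y := by ext l; simp [add_mul, Finset.sum_add_distrib]
  map_smul' c x := by ext l; simp [Finset.mul_sum, mul_assoc]

lemma norm_tailCombination_sq {k n : ℕ} (r : Fin k → Fin (n + 1) → ℝ)
    (β : EuclideanSpace ℝ (Fin k)) :
    ‖tailCombination r β‖ ^ 2 = ∑ l : Fin n, (∑ j, β j * r j l.succ) ^ 2 := by
  rw [EuclideanSpace.real_norm_sq_eq]
  rfl

lemma norm_tailCombination_sq_le {k n : ℕ} (r : Fin k → Fin (n + 1) → ℝ)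
    (β : EuclideanSpace ℝ (Fin k)) :
    ‖tailCombination r β‖ ^ 2 ≤ (∑ l : Fin n, ∑ j, r j l.succ ^ 2) * ‖β‖ ^ 2 := by
  rw [norm_tailCombination_sq, EuclideanSpace.real_norm_sq_eq, Finset.sum_mul]
  refine Finset.sum_le_sum fun l _ => ?_
  rw [mul_comm]
  exact Finset.sum_mul_sq_le_sq_mul_sq _ _ _

open scoped Matrix in
/-- Deterministic expansion of the largest eigenvalue. -/
lemma abs_largestEigenvalue_sub_le {k n : ℕ}
    (b : OrthonormalBasis (Fin (k + 1)) ℝ (EuclideanSpace ℝ (Fin (k + 1)))) {s : ℝ} (σ : ℝ)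
    (hs : 0 < s) (ξ : Fin (n + 1) → ℝ) (r : Fin k → Fin (n + 1) → ℝ)
    {X Y F θ : ℝ} (hX : X = ∑ i, ξ i ^ 2) (hX0 : 0 < X) (hY : Y = ∑ j, r j 0 ^ 2)
    (hF : F = ∑ l : Fin n, ∑ j, r j l.succ ^ 2)
    (hθ : θ = ∑ l : Fin n, (∑ j, r j 0 * r j l.succ) ^ 2)
    (h : 2 * σ ^ 2 * F ≤ s ^ 2 * X) :
    |largestEigenvalue (∑ i, Matrix.vecMulVec (spikedColumns b s σ ξ r i)
        (spikedColumns b s σ ξ r i)) - (s ^ 2 * X + σ ^ 2 * Y + σ ^ 4 * θ / (s ^ 2 * X))| ≤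
      σ ^ 6 * (θ * (2 * F + Y)) / (s ^ 2 * X) ^ 2 := by
  have hn : ‖WithLp.toLp 2 ξ‖ ^ 2 = X := by rw [EuclideanSpace.real_norm_sq_eq, hX]
  have hn0 : 0 < ‖WithLp.toLp 2 ξ‖ := by
    by_contra! hc
    have := le_antisymm hc (norm_nonneg _)
    rw [this] at hn
    norm_num at hn
    linarith
  set w : EuclideanSpace ℝ (Fin k) := WithLp.toLp 2 fun j => r j 0 with hw
  have hwY : ‖w‖ ^ 2 = Y := by rw [EuclideanSpace.real_norm_sq_eq, hY]
  have hBw : ‖tailCombination r w‖ ^ 2 = θ := by rw [norm_tailCombination_sq, hθ]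
  set a := s * ‖WithLp.toLp 2 ξ‖ with ha
  have ha0 : 0 < a := by positivity
  have ha2 : a ^ 2 = s ^ 2 * X := by rw [ha, mul_pow, hn]
  have hY0 : 0 ≤ Y := by rw [← hwY]; positivity
  have hθ0 : 0 ≤ θ := by rw [← hBw]; positivity
  have hF0 : 0 ≤ F := by rw [hF]; positivity
  set H := ∑ i, Matrix.vecMulVec (spikedColumns b s σ ξ r i) (spikedColumns b s σ ξ r i) with hH
  have hHerm : H.IsHermitian := isHermitian_sum_vecMulVec _
  have hupper : largestEigenvalue H ≤
      a ^ 2 + σ ^ 2 * Y + σ ^ 4 * θ / a ^ 2 + 2 * σ ^ 6 * θ * F / a ^ 4 := by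
    refine hHerm.largestEigenvalue_le fun x => ?_
    rw [hH, dotProduct_sum_vecMulVec_mulVec, sum_inner_spikedColumns_sq]
    set β : EuclideanSpace ℝ (Fin k) := WithLp.toLp 2 fun j => inner ℝ (b j.succ) (WithLp.toLp 2 x)
      with hβ
    have key := bordered_rayleigh_le (tailCombination r) w β (inner ℝ (b 0) (WithLp.toLp 2 x)) σ
      ha0 (norm_tailCombination_sq_le r) (by rw [← hF]; exact hF0) (by rw [← hF, ha2]; exact h)
    rw [hBw, hwY, ← hF, norm_tailCombination_sq] at key
    have e1 : inner ℝ β w = ∑ j, inner ℝ (b j.succ) (WithLp.toLp 2 x) * r j 0 := by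
      simp [PiLp.inner_apply, hβ, hw, mul_comm]
    have e2 : inner ℝ (b 0) (WithLp.toLp 2 x) ^ 2 + ‖β‖ ^ 2 = x ⬝ᵥ x := by
      rw [EuclideanSpace.real_norm_sq_eq, hβ]
      have := b.sum_sq_inner_right (WithLp.toLp 2 x)
      rw [Fin.sum_univ_succ] at this
      rw [this, EuclideanSpace.real_norm_sq_eq]
      simp [dotProduct, pow_two]
    rw [e1, e2] at key
    exact key
  have hlower : a ^ 2 + σ ^ 2 * Y + σ ^ 4 * θ / a ^ 2 - σ ^ 6 * θ * Y / a ^ 4 ≤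
      largestEigenvalue H := by
    refine rayleigh_lower_bound σ ha0 hY0 hθ0 ?_
    -- Trial vector: the top eigenvector of the rank-one part.
    set x : EuclideanSpace ℝ (Fin (k + 1)) := a • b 0 + ∑ j : Fin k, (σ * r j 0) • b j.succ with hx
    have key := hHerm.dotProduct_mulVec_le_largestEigenvalue x.ofLp
    rw [hH, dotProduct_sum_vecMulVec_mulVec, sum_inner_spikedColumns_sq, ← hH] at key
    have c0 : inner ℝ (b 0) x = a := by
      rw [hx, inner_add_right, inner_sum]
      simp [real_inner_smul_right, (Fin.succ_ne_zero _).symm]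
    have c1 : ∀ j : Fin k, inner ℝ (b j.succ) x = σ * r j 0 := by
      intro j
      rw [hx, inner_add_right, inner_sum]
      simp [real_inner_smul_right, OrthonormalBasis.inner_eq_ite]
    have e2 : x.ofLp ⬝ᵥ x.ofLp = a ^ 2 + σ ^ 2 * Y := by
      have := b.sum_sq_inner_right x
      rw [EuclideanSpace.real_norm_sq_eq, Fin.sum_univ_succ, c0] at this
      simp_rw [c1, mul_pow] at this
      rw [← Finset.mul_sum, ← hY] at this
      simpa [dotProduct, pow_two] using this.symm
    rw [e2] at key
    simp only [WithLp.toLp_ofLp, c0, c1, ← ha] at key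
    refine le_of_eq_of_le ?_ key
    have e3 : σ * ∑ j, σ * r j 0 * r j 0 = σ ^ 2 * Y := by
      rw [hY, Finset.mul_sum, Finset.mul_sum]
      exact Finset.sum_congr rfl fun j _ => by ring
    have e4 : ∑ l : Fin n, (∑ j, σ * r j 0 * r j l.succ) ^ 2 = σ ^ 2 * θ := by
      rw [hθ, Finset.mul_sum]
      refine Finset.sum_congr rfl fun l _ => ?_
      rw [← mul_pow, Finset.mul_sum]
      simp [mul_assoc]
    rw [e3, e4]
    ring
  have ha4 : a ^ 4 = (s ^ 2 * X) ^ 2 := by rw [← ha2]; ring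
  rw [ha2, ha4] at hupper hlower
  have d0 : 0 < (s ^ 2 * X) ^ 2 := by positivity
  have d1 : σ ^ 6 * (θ * (2 * F + Y)) / (s ^ 2 * X) ^ 2 =
      2 * σ ^ 6 * θ * F / (s ^ 2 * X) ^ 2 + σ ^ 6 * θ * Y / (s ^ 2 * X) ^ 2 := by ring
  have d2 : 0 ≤ 2 * σ ^ 6 * θ * F / (s ^ 2 * X) ^ 2 := by positivity
  have d3 : 0 ≤ σ ^ 6 * θ * Y / (s ^ 2 * X) ^ 2 := by positivity
  rw [d1, abs_le]
  constructor <;> linarith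

/-! ### Product Gaussian measures and their linear images. -/

namespace MeasureTheory

variable {ι κ X : Type*} [Fintype ι] [Fintype κ] [MeasurableSpace X] (μ : Measure X)
  [IsProbabilityMeasure μ]

lemma measurePreserving_curry : MeasurePreserving (MeasurableEquiv.curry ι κ X)
    (Measure.pi fun _ => μ) (Measure.pi fun _ => Measure.pi fun _ => μ) where
  measurable := MeasurableEquiv.measurable _
  map_eq := by
    have := Measure.infinitePi_map_curry (ι := ι) (κ := κ) (fun _ _ => μ)
    simpa only [Measure.infinitePi_eq_pi] using this

lemma measurePreserving_transpose : MeasurePreserving (fun (r : ι → κ → X) j i => r i j)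
    (Measure.pi fun _ => Measure.pi fun _ => μ) (Measure.pi fun _ => Measure.pi fun _ => μ) :=
  (measurePreserving_curry μ).comp
    ((measurePreserving_arrowCongr' (fun _ : ι × κ => μ) (fun _ : κ × ι => μ) (Equiv.prodComm ι κ)
      (MeasurableEquiv.refl X) (fun _ => MeasurePreserving.id μ)).comp
      ((measurePreserving_curry μ).symm _))

end MeasureTheory

namespace ProbabilityTheory

variable {ι : Type*} [Fintype ι]

section Combination

variable {E : Type*} [NormedAddCommGroup E] [InnerProductSpace ℝ E] [MeasurableSpace E]
  [BorelSpace E] [SecondCountableTopology E]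

open scoped RealInnerProductSpace in
lemma charFun_map_sum_smul_gaussian (u : ι → E) (t : E) :
    charFun ((Measure.pi fun _ : ι => gaussianReal 0 1).map fun x => ∑ i, x i • u i) t =
      Complex.exp (-(∑ i, ⟪u i, t⟫ ^ 2 : ℝ) / 2) := by
  rw [charFun_apply, integral_map (Measurable.aemeasurable (by fun_prop))
    (Measurable.aestronglyMeasurable (by fun_prop))]
  simp_rw [sum_inner, Complex.ofReal_sum, Finset.sum_mul, Complex.exp_sum,
    integral_fintype_prod_eq_prod (f := fun i x ↦ Complex.exp (⟪x • u i, t⟫ * Complex.I)),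
    real_inner_smul_left, mul_comm _ (⟪_, _⟫), Complex.ofReal_mul, ← charFun_apply_real,
    charFun_gaussianReal]
  simp [← Complex.exp_sum, Finset.sum_div, neg_div]

end Combination

lemma measurePreserving_sum_mul_gaussian {c : ι → ℝ} (hc : ∑ i, c i ^ 2 = 1) :
    MeasurePreserving (fun x : ι → ℝ => ∑ i, c i * x i) (Measure.pi fun _ => gaussianReal 0 1)
      (gaussianReal 0 1) where
  measurable := by fun_prop
  map_eq := by
    refine Measure.ext_of_charFun (funext fun t => ?_)
    have := charFun_map_sum_smul_gaussian c t
    simp only [smul_eq_mul, mul_comm _ (c _)] at this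
    rw [this, charFun_gaussianReal]
    have e : ∑ i, inner ℝ (c i) t ^ 2 = t ^ 2 := by
      simp [mul_pow, ← Finset.mul_sum, hc]
    rw [e]
    simp [neg_div]

lemma measurePreserving_headReflection {n : ℕ} (x : Fin (n + 1) → ℝ) :
    MeasurePreserving (headReflection x) (Measure.pi fun _ => gaussianReal 0 1)
      (Measure.pi fun _ => gaussianReal 0 1) := by
  have h1 : MeasurePreserving (WithLp.toLp 2 : (Fin (n + 1) → ℝ) → _)
      (Measure.pi fun _ => gaussianReal 0 1) (stdGaussian (EuclideanSpace ℝ (Fin (n + 1)))) :=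
    ⟨by fun_prop, map_pi_eq_stdGaussian⟩
  have h2 : MeasurePreserving (WithLp.ofLp : EuclideanSpace ℝ (Fin (n + 1)) → _)
      (stdGaussian (EuclideanSpace ℝ (Fin (n + 1)))) (Measure.pi fun _ => gaussianReal 0 1) :=
    h1.symm (MeasurableEquiv.toLp 2 _)
  exact h2.comp (MeasurePreserving.comp ⟨by fun_prop, stdGaussian_map _⟩ h1)

lemma measurable_headReflection {n : ℕ} :
    Measurable fun p : (Fin (n + 1) → ℝ) × (Fin (n + 1) → ℝ) => headReflection p.1 p.2 := by
  -- Writing the target of the reflection as `t • e` makes its dependence on `‖x‖` visibly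
  -- measurable.
  obtain ⟨e, he⟩ : ∃ e : EuclideanSpace ℝ (Fin (n + 1)),
      ∀ t : ℝ, EuclideanSpace.single 0 t = t • e :=
    ⟨EuclideanSpace.single 0 1, fun t => by ext i; simp⟩
  simp only [headReflection, Submodule.reflection_orthogonal_apply,
    Submodule.reflection_singleton_apply, he, RCLike.ofReal_real_eq_id, id_eq]
  fun_prop

end ProbabilityTheory

/-! ### The Wishart matrix and the three chi-squares from one Gaussian source. -/

namespace ProbabilityTheory

/-- The standard Gaussian vector `ξ`, `k` further ones `r` of the same length, and one of length
`n`, all independent. -/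
noncomputable def spikedSource (k n : ℕ) :
    Measure ((Fin (n + 1) → ℝ) × (Fin k → Fin (n + 1) → ℝ) × (Fin n → ℝ)) :=
  (Measure.pi fun _ => gaussianReal 0 1).prod
    ((Measure.pi fun _ => Measure.pi fun _ => gaussianReal 0 1).prod
      (Measure.pi fun _ => gaussianReal 0 1))

instance (k n : ℕ) : IsProbabilityMeasure (spikedSource k n) := by
  unfold spikedSource
  infer_instance

lemma posSemidef_spikedCov {m : ℕ} (σ : ℝ) {lam : ℝ} (hlam : 0 ≤ lam)
    (v : EuclideanSpace ℝ (Fin m)) : (spikedCov σ lam v).PosSemidef := by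
  refine Matrix.PosSemidef.add (Matrix.PosSemidef.one.smul (sq_nonneg σ)) ?_
  have := Matrix.posSemidef_vecMulVec_self_star (R := ℝ) v.ofLp
  rw [star_trivial] at this
  exact this.smul hlam

open scoped Matrix RealInnerProductSpace in
lemma dotProduct_spikedCov_mulVec {m : ℕ} (σ lam : ℝ) (v x : EuclideanSpace ℝ (Fin m)) :
    x ⬝ᵥ spikedCov σ lam v *ᵥ x = σ ^ 2 * ‖x‖ ^ 2 + lam * ⟪v, x⟫ ^ 2 := by
  rw [spikedCov, Matrix.add_mulVec, Matrix.smul_mulVec, Matrix.smul_mulVec, Matrix.one_mulVec,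
    Matrix.vecMulVec_mulVec, EuclideanSpace.real_norm_sq_eq,
    EuclideanSpace.inner_eq_star_dotProduct]
  simp only [dotProduct_add, dotProduct_smul, MulOpposite.smul_eq_mul_unop, MulOpposite.unop_op,
    star_trivial, smul_eq_mul]
  rw [dotProduct_comm v.ofLp x.ofLp]
  congr 1
  · simp [dotProduct, pow_two]
  · ring

variable {k n : ℕ}

lemma measurePreserving_spikedCombination
    (b : OrthonormalBasis (Fin (k + 1)) ℝ (EuclideanSpace ℝ (Fin (k + 1)))) (σ : ℝ) {lam s : ℝ}
    (hlam : 0 ≤ lam) (hs : s ^ 2 = lam + σ ^ 2) :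
    MeasurePreserving
      (fun x : Fin (k + 1) → ℝ => (s * x 0) • b 0 + ∑ j : Fin k, (σ * x j.succ) • b j.succ)
      (Measure.pi fun _ => gaussianReal 0 1) (multivariateGaussian 0 (spikedCov σ lam (b 0))) where
  measurable := by fun_prop
  map_eq := by
    refine Measure.ext_of_charFun (funext fun t => ?_)
    have h := charFun_map_sum_smul_gaussian
      (Fin.cons (s • b 0) fun j : Fin k => σ • b j.succ : Fin (k + 1) → _) t
    simp only [Fin.sum_univ_succ, Fin.cons_zero, Fin.cons_succ, smul_smul, mul_comm _ s,
      mul_comm _ σ] at h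
    rw [h, charFun_multivariateGaussian (posSemidef_spikedCov σ hlam _),
      dotProduct_spikedCov_mulVec, ← b.sum_sq_inner_right t, Fin.sum_univ_succ]
    simp only [real_inner_smul_left, mul_pow, ← Finset.mul_sum, hs, inner_zero_right]
    push_cast
    ring_nf

/-- For each fixed `ξ` the reflection preserves the Gaussian law of every `r j`, so rotating by a
`ξ`-dependent map still yields independent Gaussian rows. Transposing gives independent columns,
each with the spiked covariance. -/
lemma measurePreserving_spikedColumns
    (b : OrthonormalBasis (Fin (k + 1)) ℝ (EuclideanSpace ℝ (Fin (k + 1)))) (σ : ℝ) {lam s : ℝ}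
    (hlam : 0 ≤ lam) (hs : s ^ 2 = lam + σ ^ 2) :
    MeasurePreserving
      (fun p : (Fin (n + 1) → ℝ) × (Fin k → Fin (n + 1) → ℝ) => spikedColumns b s σ p.1 p.2)
      ((Measure.pi fun _ => gaussianReal 0 1).prod
        (Measure.pi fun _ => Measure.pi fun _ => gaussianReal 0 1))
      (Measure.pi fun _ => multivariateGaussian 0 (spikedCov σ lam (b 0))) := by
  have hrot : MeasurePreserving
      (fun p : (Fin (n + 1) → ℝ) × (Fin k → Fin (n + 1) → ℝ) =>
        (p.1, fun j => headReflection p.1 (p.2 j)))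
      ((Measure.pi fun _ => gaussianReal 0 1).prod
        (Measure.pi fun _ => Measure.pi fun _ => gaussianReal 0 1))
      ((Measure.pi fun _ => gaussianReal 0 1).prod
        (Measure.pi fun _ => Measure.pi fun _ => gaussianReal 0 1)) := by
    refine (MeasurePreserving.id _).skew_product
      (g := fun x (r : Fin k → Fin (n + 1) → ℝ) j => headReflection x (r j)) ?_
      (ae_of_all _ fun x => (measurePreserving_pi _ _
        fun _ => measurePreserving_headReflection x).map_eq)
    exact measurable_pi_iff.2 fun j => measurable_headReflection.comp
      (f := fun p : (Fin (n + 1) → ℝ) × (Fin k → Fin (n + 1) → ℝ) => (p.1, p.2 j)) (by fun_prop)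
  have hcons := (measurePreserving_piFinSuccAbove
    (fun _ : Fin (k + 1) => Measure.pi fun _ : Fin (n + 1) => gaussianReal 0 1) 0).symm
  have htr := measurePreserving_transpose (ι := Fin (k + 1)) (κ := Fin (n + 1)) (gaussianReal 0 1)
  have hpi := measurePreserving_pi (fun _ : Fin (n + 1) => _) _
    fun _ => measurePreserving_spikedCombination b σ hlam hs
  exact hpi.comp (htr.comp (hcons.comp hrot))

lemma measurePreserving_wishart
    (b : OrthonormalBasis (Fin (k + 1)) ℝ (EuclideanSpace ℝ (Fin (k + 1)))) (σ : ℝ) {lam s : ℝ}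
    (hlam : 0 ≤ lam) (hs : s ^ 2 = lam + σ ^ 2) :
    MeasurePreserving
      (fun p : (Fin (n + 1) → ℝ) × (Fin k → Fin (n + 1) → ℝ) × (Fin n → ℝ) =>
        ∑ i, Matrix.vecMulVec (spikedColumns b s σ p.1 p.2.1 i) (spikedColumns b s σ p.1 p.2.1 i))
      (spikedSource k n) (wishart (k + 1) (n + 1) (spikedCov σ lam (b 0))) := by
  have hgram : Measurable fun z : Fin (n + 1) → EuclideanSpace ℝ (Fin (k + 1)) =>
      ∑ i, Matrix.vecMulVec (z i) (z i) := by
    refine measurable_pi_iff.2 fun a => measurable_pi_iff.2 fun c => ?_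
    simp only [Matrix.sum_apply, Matrix.vecMulVec_apply]
    fun_prop
  have h1 : MeasurePreserving
      (fun p : (Fin (n + 1) → ℝ) × (Fin k → Fin (n + 1) → ℝ) × (Fin n → ℝ) => (p.1, p.2.1))
      (spikedSource k n) ((Measure.pi fun _ => gaussianReal 0 1).prod
        (Measure.pi fun _ => Measure.pi fun _ => gaussianReal 0 1)) :=
    (MeasurePreserving.id _).prod measurePreserving_fst
  have h2 : MeasurePreserving (fun z : Fin (n + 1) → EuclideanSpace ℝ (Fin (k + 1)) =>
      ∑ i, Matrix.vecMulVec (z i) (z i)) _ (wishart (k + 1) (n + 1) (spikedCov σ lam (b 0))) :=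
    ⟨hgram, rfl⟩
  exact h2.comp ((measurePreserving_spikedColumns b σ hlam hs).comp h1)

/-- The coordinates of the tails of the vectors `r j` in the direction of the vector of heads, and
`ζ` if the heads vanish. -/
noncomputable def tailProjection (w : Fin k → ℝ) (t : Fin k → Fin n → ℝ) (ζ : Fin n → ℝ) :
    Fin n → ℝ :=
  if ∑ j, w j ^ 2 = 0 then ζ else fun l => ∑ j, (w j / √(∑ j, w j ^ 2)) * t j l

lemma measurable_tailProjection : Measurable fun p : (Fin k → ℝ) × (Fin k → Fin n → ℝ) ×
    (Fin n → ℝ) => tailProjection p.1 p.2.1 p.2.2 := by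
  unfold tailProjection
  refine Measurable.ite (measurableSet_eq_fun (by fun_prop) (by fun_prop)) (by fun_prop) ?_
  fun_prop

/-- A unit combination of standard Gaussians is standard Gaussian. The law does not depend on `w`,
which yields independence from the heads. The spare vector covers `w = 0`, in particular `k = 0`,
where `Z` must still be chi-square. -/
lemma measurePreserving_tailProjection (w : Fin k → ℝ) :
    MeasurePreserving (fun p : (Fin k → Fin n → ℝ) × (Fin n → ℝ) => tailProjection w p.1 p.2)
      ((Measure.pi fun _ => Measure.pi fun _ => gaussianReal 0 1).prod
        (Measure.pi fun _ => gaussianReal 0 1)) (Measure.pi fun _ => gaussianReal 0 1) := by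
  unfold tailProjection
  split_ifs with h
  · exact measurePreserving_snd
  · have hpos : 0 < ∑ j, w j ^ 2 := lt_of_le_of_ne (by positivity) (Ne.symm h)
    have hc : ∑ i, (w i / √(∑ j, w j ^ 2)) ^ 2 = 1 := by
      simp_rw [div_pow, Real.sq_sqrt hpos.le, ← Finset.sum_div]
      exact div_self h
    exact ((measurePreserving_pi (fun _ : Fin n => _) _
      fun _ => measurePreserving_sum_mul_gaussian hc).comp
      (measurePreserving_transpose (gaussianReal 0 1))).comp measurePreserving_fst

/-- Turns the second-order term `‖B w‖²` into the product of two chi-squares. -/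
lemma sum_tailProjection_sq_mul (w : Fin k → ℝ) (t : Fin k → Fin n → ℝ) (ζ : Fin n → ℝ) :
    (∑ j, w j ^ 2) * ∑ l, tailProjection w t ζ l ^ 2 = ∑ l, (∑ j, w j * t j l) ^ 2 := by
  unfold tailProjection
  split_ifs with h
  · have hw (j : Fin k) : w j = 0 := by
      simpa using (Finset.sum_eq_zero_iff_of_nonneg fun i _ => sq_nonneg (w i)).1 h j
        (Finset.mem_univ _)
    simp [hw]
  · have hpos : 0 < ∑ j, w j ^ 2 := lt_of_le_of_ne (by positivity) (Ne.symm h)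
    simp_rw [div_mul_eq_mul_div, ← Finset.sum_div, div_pow, Real.sq_sqrt hpos.le,
      ← Finset.sum_div]
    field_simp

/-- The squared norm of `ξ`. -/
noncomputable def sourceX (p : (Fin (n + 1) → ℝ) × (Fin k → Fin (n + 1) → ℝ) × (Fin n → ℝ)) : ℝ :=
  ∑ i, p.1 i ^ 2

/-- The squared norm of the vector of heads of `r`. -/
noncomputable def sourceY (p : (Fin (n + 1) → ℝ) × (Fin k → Fin (n + 1) → ℝ) × (Fin n → ℝ)) : ℝ :=
  ∑ j, p.2.1 j 0 ^ 2

/-- The squared norm of the projected tails of `r`. -/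
noncomputable def sourceZ (p : (Fin (n + 1) → ℝ) × (Fin k → Fin (n + 1) → ℝ) × (Fin n → ℝ)) : ℝ :=
  ∑ l, tailProjection (fun j => p.2.1 j 0) (fun j l => p.2.1 j l.succ) p.2.2 l ^ 2

lemma measurePreserving_sum_sq (n : ℕ) :
    MeasurePreserving (fun x : Fin n → ℝ => ∑ i, x i ^ 2) (Measure.pi fun _ => gaussianReal 0 1)
      (chiSquare n) :=
  ⟨by fun_prop, rfl⟩

instance (n : ℕ) : IsProbabilityMeasure (chiSquare n) :=
  Measure.isProbabilityMeasure_map (measurePreserving_sum_sq n).measurable.aemeasurable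

lemma measurePreserving_sourceXYZ : MeasurePreserving
    (fun p => (sourceX p, sourceY p, sourceZ p)) (spikedSource k n)
    ((chiSquare (n + 1)).prod ((chiSquare k).prod (chiSquare n))) := by
  have hsplit : MeasurePreserving
      (fun r : Fin k → Fin (n + 1) → ℝ => (fun j => r j 0, fun j (l : Fin n) => r j l.succ))
      (Measure.pi fun _ => Measure.pi fun _ => gaussianReal 0 1)
      ((Measure.pi fun _ => gaussianReal 0 1).prod
        (Measure.pi fun _ => Measure.pi fun _ => gaussianReal 0 1)) :=
    (measurePreserving_arrowProdEquivProdArrow ℝ (Fin n → ℝ) (Fin k) (fun _ => gaussianReal 0 1)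
      (fun _ => Measure.pi fun _ => gaussianReal 0 1)).comp
      (measurePreserving_pi _ _ fun _ =>
        measurePreserving_piFinSuccAbove (fun _ => gaussianReal 0 1) 0)
  have hproj := (MeasurePreserving.id (Measure.pi fun _ : Fin k => gaussianReal 0 1)).skew_product
    (g := fun w (p : (Fin k → Fin n → ℝ) × (Fin n → ℝ)) => tailProjection w p.1 p.2)
    (μc := (Measure.pi fun _ => Measure.pi fun _ => gaussianReal 0 1).prod
        (Measure.pi fun _ => gaussianReal 0 1))
    measurable_tailProjection (ae_of_all _ fun w => (measurePreserving_tailProjection w).map_eq)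
  have hassoc := measurePreserving_prodAssoc (Measure.pi fun _ : Fin k => gaussianReal 0 1)
    (Measure.pi fun _ : Fin k => Measure.pi fun _ : Fin n => gaussianReal 0 1)
    (Measure.pi fun _ : Fin n => gaussianReal 0 1)
  exact (measurePreserving_sum_sq (n + 1)).prod
    (((measurePreserving_sum_sq k).prod (measurePreserving_sum_sq n)).comp
      (hproj.comp (hassoc.comp (hsplit.prod (MeasurePreserving.id _)))))

end ProbabilityTheory

/-! ### Coupling a given random matrix to the Gaussian source. -/

lemma isChiSquareTriple_of_hasLaw {Ω : Type*} [MeasurableSpace Ω] {P : Measure Ω}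
    [IsProbabilityMeasure P] {m n : ℕ} {X Y Z : Ω → ℝ}
    (h : HasLaw (fun ω => (X ω, Y ω, Z ω))
      ((chiSquare n).prod ((chiSquare (m - 1)).prod (chiSquare (n - 1)))) P) :
    IsChiSquareTriple P m n X Y Z := by
  have hX : HasLaw X (chiSquare n) P := measurePreserving_fst.comp_hasLaw h
  have hYZ : HasLaw (fun ω => (Y ω, Z ω)) ((chiSquare (m - 1)).prod (chiSquare (n - 1))) P :=
    measurePreserving_snd.comp_hasLaw h
  have hY : HasLaw Y (chiSquare (m - 1)) P := measurePreserving_fst.comp_hasLaw hYZ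
  have hZ : HasLaw Z (chiSquare (n - 1)) P := measurePreserving_snd.comp_hasLaw hYZ
  refine ⟨hX, hY, hZ, ?_⟩
  have hae : ∀ i, AEMeasurable (![X, Y, Z] i) P := by
    intro i
    fin_cases i
    exacts [hX.aemeasurable, hY.aemeasurable, hZ.aemeasurable]
  rw [iIndepFun_iff_map_fun_eq_pi_map hae]
  have (i : Fin 3) : IsProbabilityMeasure (P.map (![X, Y, Z] i)) :=
    Measure.isProbabilityMeasure_map (hae i)
  refine (Measure.pi_eq fun s hs => ?_).symm
  rw [Measure.map_apply_of_aemeasurable (aemeasurable_pi_iff.2 hae) (.univ_pi hs),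
    Fin.prod_univ_three]
  simp only [Matrix.cons_val]
  rw [hX.map_eq, hY.map_eq, hZ.map_eq, mul_assoc, ← Measure.prod_prod, ← Measure.prod_prod, ← h.map_eq,
    Measure.map_apply_of_aemeasurable h.aemeasurable ((hs 0).prod ((hs 1).prod (hs 2)))]
  congr 1
  ext ω
  simp [Fin.forall_fin_succ]

/-- A random variable with the law of `G` under `μ` can be written as `G ∘ g` for a random
variable `g` with law `μ` on an extension of the probability space by a uniform variable. -/
lemma exists_hasLaw_comp_eq_fst {Ω α S : Type*} [MeasurableSpace Ω] [MeasurableSpace α]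
    [MeasurableEq α] [MeasurableSpace S] [StandardBorelSpace S] [Nonempty S] {P : Measure Ω}
    [IsProbabilityMeasure P] {μ : Measure S} [IsProbabilityMeasure μ] {G : S → α}
    (hG : Measurable G) {H : Ω → α} (hH : HasLaw H (μ.map G) P) :
    ∃ g : Ω × unitInterval → S, HasLaw g μ (P.prod volume) ∧ ∀ᵐ p ∂(P.prod volume), G (g p) = H p.1 := by
  set ν := μ.map fun s => (G s, s) with hν
  have hmeas : Measurable fun s => (G s, s) := hG.prodMk measurable_id
  have : IsProbabilityMeasure ν := Measure.isProbabilityMeasure_map hmeas.aemeasurable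
  have hfst : ν.fst = μ.map G := Measure.fst_map_prodMk measurable_id
  have : IsProbabilityMeasure (μ.map G) := Measure.isProbabilityMeasure_map hG.aemeasurable
  -- `f a` pushes the uniform law to the conditional law of `s` given `G s = a`; feeding it `H` and
  -- an independent uniform variable reproduces the joint law `ν`.
  obtain ⟨f, hf, hfν⟩ := Kernel.exists_measurable_map_eq_unitInterval ν.condKernel
  have hfm : Measurable fun q : α × unitInterval => (q.1, f q.1 q.2) := measurable_fst.prodMk hf
  have hrep : MeasurePreserving (fun q : α × unitInterval => (q.1, f q.1 q.2))
      ((μ.map G).prod volume) ν := by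
    refine ⟨hfm, ?_⟩
    rw [← ν.disintegrate ν.condKernel, hfst]
    ext s hs
    rw [Measure.map_apply hfm hs, Measure.compProd_apply hs,
      Measure.prod_apply (hfm hs)]
    refine lintegral_congr fun a => ?_
    rw [← hfν, Measure.map_apply hf.of_uncurry_left (measurable_prodMk_left hs)]
    rfl
  have hlift : HasLaw (fun p : Ω × unitInterval => (H p.1, p.2)) ((μ.map G).prod volume)
      (P.prod volume) := by
    have h1 : MeasurePreserving (hH.aemeasurable.mk H) P (μ.map G) :=
      (hH.congr hH.aemeasurable.ae_eq_mk.symm).measurePreserving hH.aemeasurable.measurable_mk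
    refine (h1.prod (MeasurePreserving.id (volume : Measure unitInterval))).hasLaw.congr ?_
    filter_upwards [Measure.quasiMeasurePreserving_fst.ae hH.aemeasurable.ae_eq_mk] with p hp
    simp [Prod.map, hp]
  have hjoint := hrep.comp_hasLaw hlift
  refine ⟨fun p => f (H p.1) p.2, ?_, ?_⟩
  · have hsnd : MeasurePreserving Prod.snd ν μ := by
      refine ⟨measurable_snd, ?_⟩
      rw [hν, Measure.map_map measurable_snd hmeas]
      exact Measure.map_id
    exact hsnd.comp_hasLaw hjoint
  -- `ν` is carried by the graph of `G`, and the pair `(H, g)` has law `ν`.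
  · have hset : MeasurableSet {q : α × S | G q.2 = q.1} :=
      measurableSet_eq_fun (hG.comp measurable_snd) measurable_fst
    refine (hjoint.ae_iff (p := fun q : α × S => G q.2 = q.1) (measurableSet_setOfPred.1 hset)).2 ?_
    rw [hν, ae_map_iff hmeas.aemeasurable hset]
    simp

lemma exists_orthonormalBasis_apply_zero_eq {k : ℕ} {v : EuclideanSpace ℝ (Fin (k + 1))}
    (hv : ‖v‖ = 1) :
    ∃ b : OrthonormalBasis (Fin (k + 1)) ℝ (EuclideanSpace ℝ (Fin (k + 1))), b 0 = v := by
  obtain ⟨b, hb⟩ := Orthonormal.exists_orthonormalBasis_extension_of_card_eq (𝕜 := ℝ)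
    (ι := Fin (k + 1)) (E := EuclideanSpace ℝ (Fin (k + 1))) (by simp) (v := fun _ => v) (s := {0})
    (by
      rw [orthonormal_iff_ite]
      intro i j
      simp [Subsingleton.elim i j, hv])
  exact ⟨b, hb 0 rfl⟩

/-! ### Error bounds in probability. -/

namespace ProbabilityTheory

variable {k n : ℕ}

lemma ae_sourceX_pos : ∀ᵐ p ∂spikedSource k n, 0 < sourceX p := by
  have : NullSingletonClass (gaussianReal 0 1) := nullSingletonClass_gaussianReal one_ne_zero
  have h1 : MeasurePreserving (fun p => p.1 0) (spikedSource k n) (gaussianReal 0 1) :=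
    (measurePreserving_eval (fun _ : Fin (n + 1) => gaussianReal 0 1) 0).comp measurePreserving_fst
  have h2 : ∀ᵐ x ∂gaussianReal 0 1, x ≠ 0 := by
    rw [ae_iff]
    simp
  filter_upwards [h1.quasiMeasurePreserving.ae h2] with p hp
  exact Finset.sum_pos' (fun _ _ => sq_nonneg _) ⟨0, Finset.mem_univ _, by positivity⟩

/-- The sum of the squares of the tails. -/
noncomputable def sourceF (p : (Fin (n + 1) → ℝ) × (Fin k → Fin (n + 1) → ℝ) × (Fin n → ℝ)) : ℝ :=
  ∑ l : Fin n, ∑ j, p.2.1 j l.succ ^ 2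

/-- The error of the expansion of the largest eigenvalue is at most `σ⁶ / lam²` times this. -/
noncomputable def sourceError
    (p : (Fin (n + 1) → ℝ) × (Fin k → Fin (n + 1) → ℝ) × (Fin n → ℝ)) : ℝ :=
  sourceY p * sourceZ p * (2 * sourceF p + sourceY p) / sourceX p ^ 2

lemma sourceF_nonneg (p : (Fin (n + 1) → ℝ) × (Fin k → Fin (n + 1) → ℝ) × (Fin n → ℝ)) :
    0 ≤ sourceF p := by
  unfold sourceF
  positivity

lemma sourceError_nonneg (p : (Fin (n + 1) → ℝ) × (Fin k → Fin (n + 1) → ℝ) × (Fin n → ℝ)) :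
    0 ≤ sourceError p := by
  unfold sourceError sourceF sourceX sourceY sourceZ
  positivity

lemma measurable_sourceXYZ : Measurable fun
    p : (Fin (n + 1) → ℝ) × (Fin k → Fin (n + 1) → ℝ) × (Fin n → ℝ) =>
      (sourceX p, sourceY p, sourceZ p) :=
  measurePreserving_sourceXYZ.measurable

lemma measurable_sourceF : Measurable (sourceF (k := k) (n := n)) := by
  unfold sourceF
  fun_prop

lemma abs_largestEigenvalue_sub_rootExpansion_le
    (b : OrthonormalBasis (Fin (k + 1)) ℝ (EuclideanSpace ℝ (Fin (k + 1)))) (σ : ℝ) {lam s : ℝ}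
    (hlam : 0 < lam) (hs : 0 < s) (hs2 : s ^ 2 = lam + σ ^ 2)
    {p : (Fin (n + 1) → ℝ) × (Fin k → Fin (n + 1) → ℝ) × (Fin n → ℝ)} (hX : 0 < sourceX p)
    (hF : 2 * σ ^ 2 * sourceF p ≤ lam * sourceX p) :
    |largestEigenvalue (∑ i, Matrix.vecMulVec (spikedColumns b s σ p.1 p.2.1 i)
        (spikedColumns b s σ p.1 p.2.1 i)) -
        rootExpansion σ lam (sourceX p) (sourceY p) (sourceZ p)| ≤
      σ ^ 6 / lam ^ 2 * sourceError p := by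
  have hle : lam ≤ s ^ 2 := by rw [hs2]; exact le_add_of_nonneg_right (sq_nonneg σ)
  have hθ : sourceY p * sourceZ p =
      ∑ l : Fin n, (∑ j, p.2.1 j 0 * p.2.1 j l.succ) ^ 2 := sum_tailProjection_sq_mul _ _ _
  have h := abs_largestEigenvalue_sub_le b σ hs p.1 p.2.1 (X := sourceX p) (Y := sourceY p)
    (F := sourceF p) rfl hX rfl rfl hθ (hF.trans (by gcongr))
  have e : rootExpansion σ lam (sourceX p) (sourceY p) (sourceZ p) =
      s ^ 2 * sourceX p + σ ^ 2 * sourceY p +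
        σ ^ 4 * (sourceY p * sourceZ p) / (s ^ 2 * sourceX p) := by
    rw [rootExpansion, hs2]
    ring
  rw [e]
  refine h.trans ?_
  have e2 : σ ^ 6 / lam ^ 2 * sourceError p =
      σ ^ 6 * (sourceY p * sourceZ p * (2 * sourceF p + sourceY p)) / (lam * sourceX p) ^ 2 := by
    rw [sourceError]
    field_simp
  rw [e2]
  have hY : 0 ≤ sourceY p := by unfold sourceY; positivity
  have hZ : 0 ≤ sourceZ p := by unfold sourceZ; positivity
  have hF' := sourceF_nonneg p
  gcongr

lemma exists_coupling {Ω : Type*} [MeasurableSpace Ω] {P : Measure Ω} [IsProbabilityMeasure P]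
    {σ lam : ℝ} (hlam : 0 < lam) {v : EuclideanSpace ℝ (Fin (k + 1))} (hv : ‖v‖ = 1)
    {H : Ω → Matrix (Fin (k + 1)) (Fin (k + 1)) ℝ}
    (hH : HasLaw H (wishart (k + 1) (n + 1) (spikedCov σ lam v)) P) :
    ∃ g : Ω × unitInterval → (Fin (n + 1) → ℝ) × (Fin k → Fin (n + 1) → ℝ) × (Fin n → ℝ),
      HasLaw g (spikedSource k n) (P.prod volume) ∧
      ∀ᵐ p ∂(P.prod volume), 2 * σ ^ 2 * sourceF (g p) ≤ lam * sourceX (g p) →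
        |largestEigenvalue (H p.1) -
          rootExpansion σ lam (sourceX (g p)) (sourceY (g p)) (sourceZ (g p))| ≤
        σ ^ 6 / lam ^ 2 * sourceError (g p) := by
  obtain ⟨b, rfl⟩ := exists_orthonormalBasis_apply_zero_eq hv
  have hs2 : √(lam + σ ^ 2) ^ 2 = lam + σ ^ 2 := Real.sq_sqrt (by positivity)
  have hG := measurePreserving_wishart (n := n) b σ hlam.le hs2
  have : MeasurableEq (Matrix (Fin (k + 1)) (Fin (k + 1)) ℝ) :=
    inferInstanceAs (MeasurableEq (Fin (k + 1) → Fin (k + 1) → ℝ))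
  rw [← hG.map_eq] at hH
  obtain ⟨g, hg, hgH⟩ := exists_hasLaw_comp_eq_fst hG.measurable hH
  refine ⟨g, hg, ?_⟩
  have hpos : ∀ᵐ p ∂(P.prod volume), 0 < sourceX (g p) := by
    have := ae_sourceX_pos (k := k) (n := n)
    rw [← hg.map_eq] at this
    exact ae_of_ae_map hg.aemeasurable this
  filter_upwards [hgH, hpos] with p hp hX hF
  rw [← hp]
  exact abs_largestEigenvalue_sub_rootExpansion_le b σ hlam (by positivity) hs2 hX hF

/-- A fixed random variable multiplied by constants tending to `0` tends to `0` in probability. -/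
lemma tendsto_measure_one_le_mul {S ι : Type*} [MeasurableSpace S] {μ : Measure S}
    [IsFiniteMeasure μ] {D : S → ℝ} (hD : Measurable D) {l : Filter ι} {c : ι → ℝ}
    (hc : Tendsto c l (𝓝[>] 0)) : Tendsto (fun i => μ {x | 1 ≤ c i * D x}) l (𝓝 0) := by
  have h1 : Tendsto (μ ∘ fun t : ℝ => {x | t ≤ D x}) atTop (𝓝 (μ (⋂ t : ℝ, {x | t ≤ D x}))) :=
    tendsto_measure_iInter_atTop
      (fun t => (measurableSet_le measurable_const hD).nullMeasurableSet)
      (fun s t hst x hx => le_trans hst hx) ⟨0, measure_ne_top _ _⟩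
  have h2 : ⋂ t : ℝ, {x | t ≤ D x} = ∅ := by
    refine Set.eq_empty_of_forall_notMem fun x hx => ?_
    have : D x + 1 ≤ D x := Set.mem_iInter.1 hx (D x + 1)
    linarith
  rw [h2, measure_empty] at h1
  refine (h1.comp hc.inv_tendsto_nhdsGT_zero).congr' ?_
  filter_upwards [hc self_mem_nhdsWithin] with i hi
  simp only [Function.comp_apply, Pi.inv_apply]
  congr 1
  ext x
  exact inv_le_iff_one_le_mul₀' (show 0 < c i from hi)

/-- Both limits at once: `σ² / lam` is the small parameter, and `hM` says that the deterministic
error is a further factor `σ² / lam` below the rate `r`. One uniform variable serves all `t`, since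
nothing is required jointly in `t`. -/
lemma exists_extension_rootExpansion {Ω : Type u} [MeasurableSpace Ω] {P : Measure Ω}
    [IsProbabilityMeasure P] {σ lam r : ℝ → ℝ} {M : ℝ} {l : Filter ℝ}
    {v : ℝ → EuclideanSpace ℝ (Fin (k + 1))}
    {H : ℝ → Ω → Matrix (Fin (k + 1)) (Fin (k + 1)) ℝ}
    (hl : ∀ᶠ t in l, 0 < t) (hσ : ∀ t, 0 < t → 0 < σ t) (hlam : ∀ t, 0 < t → 0 < lam t)
    (hr : ∀ t, 0 < t → 0 < r t)
    (hM : ∀ t, 0 < t → σ t ^ 6 / lam t ^ 2 ≤ M * (σ t ^ 2 / lam t) * r t)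
    (hκ : Tendsto (fun t => σ t ^ 2 / lam t) l (𝓝 0))
    (hv : ∀ t, 0 < t → ‖v t‖ = 1)
    (hH : ∀ t, 0 < t →
      HasLaw (H t) (wishart (k + 1) (n + 1) (spikedCov (σ t) (lam t) (v t))) P) :
    ∃ (Ω' : Type u) (_ : MeasurableSpace Ω') (P' : Measure Ω') (π : Ω' → Ω)
      (X Y Z : ℝ → Ω' → ℝ),
      IsProbabilityMeasure P' ∧ MeasurePreserving π P' P ∧
      (∀ t, 0 < t → IsChiSquareTriple P' (k + 1) (n + 1) (X t) (Y t) (Z t)) ∧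
      IsLittleOInProbability P' l
        (fun t ω => largestEigenvalue (H t (π ω))
          - rootExpansion (σ t) (lam t) (X t ω) (Y t ω) (Z t ω)) r := by
  choose! g hg hgH using fun t (ht : 0 < t) =>
    exists_coupling (n := n) (hlam t ht) (hv t ht) (hH t ht)
  refine ⟨Ω × unitInterval, inferInstance, P.prod volume, Prod.fst, fun t ω => sourceX (g t ω),
    fun t ω => sourceY (g t ω), fun t ω => sourceZ (g t ω), inferInstance, measurePreserving_fst,
    fun t ht => isChiSquareTriple_of_hasLaw (measurePreserving_sourceXYZ.comp_hasLaw (hg t ht)), ?_⟩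
  rw [IsLittleOInProbability, tendstoInMeasure_iff_norm]
  intro ε hε
  -- If the error reaches `ε r`, then either the smallness condition fails, and the first term of
  -- `D` times `σ² / lam` exceeds `1`, or the error bound makes the second term times `σ² / lam` at
  -- least `1`. The law of `D` is free of `t`.
  set D : (Fin (n + 1) → ℝ) × (Fin k → Fin (n + 1) → ℝ) × (Fin n → ℝ) → ℝ :=
    fun p => 2 * sourceF p / sourceX p + M / ε * sourceError p with hD
  have hDm : Measurable D := by
    have hX : Measurable (sourceX (k := k) (n := n)) := measurable_sourceXYZ.fst
    have hY : Measurable (sourceY (k := k) (n := n)) := measurable_sourceXYZ.snd.fst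
    have hZ : Measurable (sourceZ (k := k) (n := n)) := measurable_sourceXYZ.snd.snd
    have hF := measurable_sourceF (k := k) (n := n)
    simp only [hD, sourceError]
    fun_prop
  have hκ' : Tendsto (fun t => σ t ^ 2 / lam t) l (𝓝[>] 0) := by
    refine tendsto_nhdsWithin_iff.2 ⟨hκ, hl.mono fun t ht => ?_⟩
    have := hσ t ht
    have := hlam t ht
    exact Set.mem_Ioi.2 (by positivity)
  refine tendsto_of_tendsto_of_tendsto_of_le_of_le' tendsto_const_nhds
    (tendsto_measure_one_le_mul (μ := spikedSource k n) hDm hκ')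
    (Eventually.of_forall fun _ => zero_le) ?_
  filter_upwards [hl] with t ht
  have hσt := hσ t ht
  have hlamt := hlam t ht
  have hrt := hr t ht
  have hMt := hM t ht
  have hM0 : 0 ≤ M := by
    by_contra! hc
    have h1 : 0 < σ t ^ 6 / lam t ^ 2 := by positivity
    have h2 : M * (σ t ^ 2 / lam t) * r t < 0 :=
      mul_neg_of_neg_of_pos (mul_neg_of_neg_of_pos hc (by positivity)) hrt
    linarith
  rw [← (hg t ht).measure_eq (p := fun p => 1 ≤ σ t ^ 2 / lam t * D p)
    (measurableSet_le measurable_const (by fun_prop))]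
  have hpos : ∀ᵐ p ∂(P.prod volume), 0 < sourceX (g t p) := by
    have := ae_sourceX_pos (k := k) (n := n)
    rw [← (hg t ht).map_eq] at this
    exact ae_of_ae_map (hg t ht).aemeasurable this
  refine measure_mono_ae ?_
  filter_upwards [hgH t ht, hpos] with p hp hX (hεp : ε ≤ _)
  change 1 ≤ σ t ^ 2 / lam t * D (g t p)
  have hF := sourceF_nonneg (g t p)
  have hE := sourceError_nonneg (g t p)
  by_cases hcond : 2 * σ t ^ 2 * sourceF (g t p) ≤ lam t * sourceX (g t p)
  · have h1 := hp hcond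
    rw [sub_zero, norm_div, Real.norm_eq_abs, Real.norm_eq_abs, abs_of_pos hrt,
      le_div_iff₀ hrt] at hεp
    have h2 : ε * r t ≤ M * (σ t ^ 2 / lam t) * sourceError (g t p) * r t := by
      refine hεp.trans (h1.trans ?_)
      calc _ ≤ M * (σ t ^ 2 / lam t) * r t * sourceError (g t p) := by gcongr
        _ = _ := by ring
    have h3 := le_of_mul_le_mul_right h2 hrt
    have h4 : 1 ≤ σ t ^ 2 / lam t * (M / ε * sourceError (g t p)) := by
      calc 1 ≤ M * (σ t ^ 2 / lam t) * sourceError (g t p) / ε := (one_le_div hε).2 h3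
        _ = _ := by ring
    refine h4.trans ?_
    gcongr
    exact le_add_of_nonneg_left (by positivity)
  · push Not at hcond
    have h4 : 1 ≤ σ t ^ 2 / lam t * (2 * sourceF (g t p) / sourceX (g t p)) := by
      rw [div_mul_div_comm, le_div_iff₀ (by positivity)]
      linarith
    refine h4.trans ?_
    gcongr
    exact le_add_of_nonneg_right (by positivity)

end ProbabilityTheory

/-- In both parts, `H` is an arbitrary family of random matrices with the stated Wishart laws on
an arbitrary probability space; the chi-square variates live on an extension of that space (a
probability space `Ω'` with a measure preserving map `π` onto `Ω`). -/
theorem proposition1 (m n : ℕ) (hn : 1 ≤ n) :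
    (∀ (lam : ℝ), 0 < lam →
      ∀ (v : ℝ → EuclideanSpace ℝ (Fin m)), (∀ σ : ℝ, 0 < σ → ‖v σ‖ = 1) →
      ∀ (Ω : Type u) [MeasurableSpace Ω] (P : Measure Ω) [IsProbabilityMeasure P]
        (H : ℝ → Ω → Matrix (Fin m) (Fin m) ℝ),
        (∀ σ : ℝ, 0 < σ → HasLaw (H σ) (wishart m n (spikedCov σ lam (v σ))) P) →
        ∃ (Ω' : Type u) (_ : MeasurableSpace Ω') (P' : Measure Ω') (π : Ω' → Ω)
          (X Y Z : ℝ → Ω' → ℝ),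
          IsProbabilityMeasure P' ∧ MeasurePreserving π P' P ∧
          (∀ σ : ℝ, 0 < σ → IsChiSquareTriple P' m n (X σ) (Y σ) (Z σ)) ∧
          IsLittleOInProbability P' (𝓝[>] (0 : ℝ))
            (fun σ ω => largestEigenvalue (H σ (π ω))
              - rootExpansion σ lam (X σ ω) (Y σ ω) (Z σ ω))
            (fun σ => σ ^ 4)) ∧
    (∀ (σ : ℝ), 0 < σ →
      ∀ (v : ℝ → EuclideanSpace ℝ (Fin m)), (∀ lam : ℝ, 0 < lam → ‖v lam‖ = 1) →
      ∀ (Ω : Type u) [MeasurableSpace Ω] (P : Measure Ω) [IsProbabilityMeasure P]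
        (H : ℝ → Ω → Matrix (Fin m) (Fin m) ℝ),
        (∀ lam : ℝ, 0 < lam → HasLaw (H lam) (wishart m n (spikedCov σ lam (v lam))) P) →
        ∃ (Ω' : Type u) (_ : MeasurableSpace Ω') (P' : Measure Ω') (π : Ω' → Ω)
          (X Y Z : ℝ → Ω' → ℝ),
          IsProbabilityMeasure P' ∧ MeasurePreserving π P' P ∧
          (∀ lam : ℝ, 0 < lam → IsChiSquareTriple P' m n (X lam) (Y lam) (Z lam)) ∧
          IsLittleOInProbability P' atTop
            (fun lam ω => largestEigenvalue (H lam (π ω))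
              - rootExpansion σ lam (X lam ω) (Y lam ω) (Z lam ω))
            (fun lam => 1 / lam)) := by
  obtain ⟨n, rfl⟩ := Nat.exists_eq_add_of_le' hn
  cases m with
  -- There is no unit vector in `ℝ^0`.
  | zero =>
    have hzero (w : EuclideanSpace ℝ (Fin 0)) : ‖w‖ ≠ 1 := by simp [Subsingleton.elim w 0]
    exact ⟨fun _ _ v hv => (hzero _ (hv 1 one_pos)).elim,
      fun _ _ v hv => (hzero _ (hv 1 one_pos)).elim⟩
  | succ k =>
    constructor
    · intro lam hlam v hv Ω _ P _ H hH
      refine exists_extension_rootExpansion (σ := fun σ => σ) (lam := fun _ => lam)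
        (M := 1 / lam) self_mem_nhdsWithin (fun _ h => h) (fun _ _ => hlam)
        (fun _ _ => by positivity) (fun σ _ => le_of_eq ?_) ?_ hv hH
      · field_simp
      · have h : Continuous fun σ : ℝ => σ ^ 2 / lam := by fun_prop
        simpa using (h.tendsto 0).mono_left nhdsWithin_le_nhds
    · intro σ hσ v hv Ω _ P _ H hH
      refine exists_extension_rootExpansion (σ := fun _ => σ) (lam := fun lam => lam)
        (M := σ ^ 4) (eventually_gt_atTop 0) (fun _ _ => hσ) (fun _ h => h)
        (fun _ _ => by positivity) (fun lam hlam => le_of_eq ?_)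
        (tendsto_const_nhds.div_atTop tendsto_id) hv hH
      field_simp
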